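/- Consider a convolutional layer with batch size $B\ge 1$, output images of size $W_O\times H_O$ with $C_O$ channels, $C_O$ kernels of size $W_K\times H_K\times C_I$, and stride $D\ge 1$ (all dimensions at least $1$), where the stride does not exceed the kernel size: $D\le W_K$ and $D\le H_K$. The input images have $C_I$ channels of size $(D(W_O-1)+W_K)\times(D(H_O-1)+H_K)$, and the output entry at position $(x,y)$ of channel $c$ of image $b$ is $$\sum_{i<W_K}\ \sum_{j<H_K}\ \sum_{d<C_I}\mathrm{input}_b(Dx+i,\,Dy+j,\,d)\cdot\mathrm{weight}_c(i,j,d).$$ The ordinary convolution algorithm is described by a directed acyclic graph: its input nodes are the entries of the inputs and of the weights; each of the $K=W_KH_KC_I$ terms of each output is produced by its own multiplication node, whose predecessors are the input entry and the weight; and the terms of each output are summed up by an add tree of $K$ addition nodes with one or two operands each (the accumulator starts from zero), in an arbitrary order and association, no node being shared between the trees of different outputs. Let $R=W_KH_K/D^2$ be the window-reuse factor. The graph is computed in the red-blue pebble game of Hong and Kung with a fast (on-chip) memory that holds at most $S\ge 1$ data entries and an unlimited slow (off-chip) memory. At the start exactly the input nodes are in the slow memory and the fast memory is empty. A move copies an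 entry from the slow to the fast memory or from the fast to the slow memory (a transfer), places in the fast memory the result of a non-input node all of whose predecessors are in the fast memory, or discards an entry of either memory. At the end all outputs have to be in the slow memory. The off-chip communication volume is the number of transfers. Then the off-chip communication volume is $\Omega\!\left(\frac{BW_OH_OC_OW_KH_KC_I}{\sqrt{RS}}\right)$: there is an absolute constant $c>0$ such that, for all such layers, all choices of the add trees and all $S$, every complete computation has off-chip communication volume $$Q\ \ge\ c\cdot\frac{B\,W_O\,H_O\,C_O\,W_K\,H_K\,C_I}{\sqrt{RS}} .$$ -/

import Mathlib

/-! ## The red-blue pebble game (Hong and Kung) -/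

namespace RedBlue

/-- A configuration of the game: the nodes that carry a red pebble (data held in the fast memory)
and the nodes that carry a blue pebble (data held in the slow memory). -/
structure Config (V : Type*) where
  red : Set V
  blue : Set V

/-- The inputs of a directed graph: the nodes without immediate predecessors. -/
def inputs {V : Type*} (E : V → V → Prop) : Set V := {v | ∀ u, ¬ E u v}

/-- The outputs of a directed graph: the nodes without immediate successors. -/
def outputs {V : Type*} (E : V → V → Prop) : Set V := {v | ∀ w, ¬ E v w}

/-- `Step E S c c' q`: one legal move leads from `c` to `c'` on the graph with edge relation `E`
(`E u v` says that `v` depends immediately on `u`), when the fast memory holds at most `S` data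
entries; `q` is the number of data entries that the move transfers between the two memories. -/
inductive Step {V : Type*} (E : V → V → Prop) (S : ℕ) : Config V → Config V → ℕ → Prop
  /-- Read an entry of the slow memory into the fast memory. -/
  | load (c : Config V) (v : V) (hv : v ∈ c.blue) (hS : (insert v c.red).encard ≤ S) :
      Step E S c ⟨insert v c.red, c.blue⟩ 1
  /-- Write an entry of the fast memory to the slow memory. -/
  | store (c : Config V) (v : V) (hv : v ∈ c.red) :
      Step E S c ⟨c.red, insert v c.blue⟩ 1
  /-- Compute a non-input node all of whose immediate predecessors are in the fast memory. -/
  | compute (c : Config V) (v : V) (hv : v ∉ inputs E) (hpred : ∀ u, E u v → u ∈ c.red)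
      (hS : (insert v c.red).encard ≤ S) :
      Step E S c ⟨insert v c.red, c.blue⟩ 0
  /-- Discard an entry of the fast memory. -/
  | deleteRed (c : Config V) (v : V) : Step E S c ⟨c.red \ {v}, c.blue⟩ 0
  /-- Discard an entry of the slow memory. -/
  | deleteBlue (c : Config V) (v : V) : Step E S c ⟨c.red, c.blue \ {v}⟩ 0

/-- `Run E S c c' q`: a finite sequence of legal moves leads from `c` to `c'`, and transfers `q`
data entries between the two memories in total. -/
inductive Run {V : Type*} (E : V → V → Prop) (S : ℕ) : Config V → Config V → ℕ → Prop
  | nil (c : Config V) : Run E S c c 0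
  | snoc {c c' c'' : Config V} {q r : ℕ} (hrun : Run E S c c' q) (hstep : Step E S c' c'' r) :
      Run E S c c'' (q + r)

/-- There is a complete computation of the graph with a fast memory of size `S` and communication
volume `q`: at the start exactly the inputs are in the slow memory and the fast memory is empty; at
the end all outputs are in the slow memory. -/
def Computes {V : Type*} (E : V → V → Prop) (S q : ℕ) : Prop :=
  ∃ c : Config V, Run E S ⟨∅, inputs E⟩ c q ∧ outputs E ⊆ c.blue

end RedBlue

/-! ## Convolutional layers -/

/-- A way to sum up the terms indexed by `ι`, `K` in number, by `K` additions with at most two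
operands each (an accumulator that starts from zero, so one of the additions has a single operand).
The additions are numbered in an order in which they can be carried out. -/
structure AddTree (ι : Type) [Fintype ι] where
  /-- The addition that takes the term `t` as an operand. -/
  termParent : ι → Fin (Fintype.card ι)
  /-- The addition that takes the result of addition `n` as an operand, if there is one. -/
  addParent : Fin (Fintype.card ι) → Option (Fin (Fintype.card ι))
  lt_of_addParent : ∀ n m, addParent n = some m → n < m
  /-- Only the result of the last addition, the whole sum, is not used by another addition. -/
  addParent_eq_none_iff : ∀ n, addParent n = none ↔ (n : ℕ) + 1 = Fintype.card ι
  one_le_operands : ∀ m,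
    1 ≤ Nat.card {t // termParent t = m} + Nat.card {n // addParent n = some m}
  operands_le_two : ∀ m,
    Nat.card {t // termParent t = m} + Nat.card {n // addParent n = some m} ≤ 2

/-- The dimensions of a convolutional layer: batch size `B`, output images of `CO` channels of size
`WO × HO`, `CO` kernels of size `WK × HK × CI`, stride `D`. -/
structure ConvLayer where
  B : ℕ
  WO : ℕ
  HO : ℕ
  CO : ℕ
  WK : ℕ
  HK : ℕ
  CI : ℕ
  D : ℕ
  B_pos : 0 < B
  WO_pos : 0 < WO
  HO_pos : 0 < HO
  CO_pos : 0 < CO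
  WK_pos : 0 < WK
  HK_pos : 0 < HK
  CI_pos : 0 < CI
  D_pos : 0 < D

namespace ConvLayer

/-- The width of the input images, which are exactly covered by the sliding windows. -/
def WI (L : ConvLayer) : ℕ := L.D * (L.WO - 1) + L.WK

/-- The height of the input images. -/
def HI (L : ConvLayer) : ℕ := L.D * (L.HO - 1) + L.HK

/-- The outputs `(b, x, y, c)`: image, position, channel. -/
abbrev Out (L : ConvLayer) : Type := Fin L.B × Fin L.WO × Fin L.HO × Fin L.CO

/-- The positions `(i, j, d)` in a kernel, with `d` the input channel. They index the terms of each
output. -/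
abbrev Ker (L : ConvLayer) : Type := Fin L.WK × Fin L.HK × Fin L.CI

/-- The window-reuse factor `WK * HK / D ^ 2`. -/
noncomputable def reuse (L : ConvLayer) : ℝ := (L.WK : ℝ) * L.HK / (L.D : ℝ) ^ 2

/-- The nodes of the graph of the ordinary convolution algorithm. -/
inductive Node (L : ConvLayer) : Type
  /-- The entry of input image `b` at position `(x, y)` of channel `d`. -/
  | input (b : Fin L.B) (x : Fin L.WI) (y : Fin L.HI) (d : Fin L.CI) : Node L
  /-- The entry at position `k` of the kernel for output channel `c`. -/
  | weight (c : Fin L.CO) (k : L.Ker) : Node L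
  /-- The multiplication that produces term `k` of output `o`. -/
  | mul (o : L.Out) (k : L.Ker) : Node L
  /-- The addition number `n` of the add tree of output `o`. -/
  | add (o : L.Out) (n : Fin (Fintype.card L.Ker)) : Node L

/-- The edges of the graph: output `(b, x, y, c)` is the sum over `(i, j, d)` of
`input b (D x + i) (D y + j) d * weight c (i, j, d)`, where the terms of the output `o` are summed
up according to the add tree `T o`. -/
inductive Edge (L : ConvLayer) (T : L.Out → AddTree L.Ker) : L.Node → L.Node → Prop
  | input_mul (b : Fin L.B) (x : Fin L.WO) (y : Fin L.HO) (c : Fin L.CO)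
      (i : Fin L.WK) (j : Fin L.HK) (d : Fin L.CI) (x' : Fin L.WI) (y' : Fin L.HI)
      (hx : (x' : ℕ) = L.D * x + i) (hy : (y' : ℕ) = L.D * y + j) :
      Edge L T (.input b x' y' d) (.mul (b, x, y, c) (i, j, d))
  | weight_mul (b : Fin L.B) (x : Fin L.WO) (y : Fin L.HO) (c : Fin L.CO) (k : L.Ker) :
      Edge L T (.weight c k) (.mul (b, x, y, c) k)
  | mul_add (o : L.Out) (k : L.Ker) : Edge L T (.mul o k) (.add o ((T o).termParent k))
  | add_add (o : L.Out) (n m : Fin (Fintype.card L.Ker)) (h : (T o).addParent n = some m) :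
      Edge L T (.add o n) (.add o m)

end ConvLayer

/-!
The proof cuts a computation into time intervals with at most `S` transfers each and bounds the
number of multiplications that an interval can contribute.

Recomputation is allowed, so one computation has to be singled out for each multiplication: the last
moment at which neither the multiplication nor any node depending on it is pebbled. The next move
must perform the multiplication, so the input entry and the weight are then in the fast memory; and
from then on some node of the same output is always pebbled
(`RedBlue.IsTrace.exists_useful_compute`). Consider the multiplications singled out in an interval.
Their operands were in the fast memory at its start or were loaded during it; their outputs have a
node in the fast memory at its end or a node that was stored during it. So at most `2 S` input
entries, `2 S` weights and `2 S` outputs are involved. No property of the add trees is needed except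
that every term contributes to the final sum.

With `X` input entries, `Y` weights and `Z` outputs at most `√(4 R X Y Z)` multiplications can be
performed (`ConvLayer.card_mul_sq_le`). Split the kernel into `D × D` blocks of positions, at most
`4 R` in number because the stride does not exceed the kernel size. Inside one block the convolution
is a matrix multiplication, and the Loomis–Whitney inequality applies; grouping the multiplications
by output and block gives all blocks at once by a single use of the Cauchy–Schwarz inequality
(`Finset.card_sq_le_of_pairs_injective`).

If `q > S`, there are at most `2 q / S` intervals of `O(√R S ^ (3/2))` multiplications each. If
`q ≤ S`, the whole computation is one interval; it starts with an empty fast memory and ends with all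
outputs stored, so `2 S` can be replaced by `q`, and `√(R q ^ 3) ≤ q √(R S)`.
-/

/-! ### Runs of the game as sequences of configurations -/

namespace RedBlue

variable {V : Type*} {E : V → V → Prop} {S : ℕ}

/-- A run of `n` moves, indexed by time: `c t` is the configuration before move `t`, and move `t`
transfers `r t` data entries. -/
structure IsTrace (E : V → V → Prop) (S n : ℕ) (c : ℕ → Config V) (r : ℕ → ℕ) : Prop where
  init : c 0 = ⟨∅, inputs E⟩
  step : ∀ t < n, Step E S (c t) (c (t + 1)) (r t)

theorem Run.exists_isTrace {c₀ c' : Config V} {q : ℕ} (h : Run E S c₀ c' q)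
    (h₀ : c₀ = ⟨∅, inputs E⟩) :
    ∃ n c r, IsTrace E S n c r ∧ c n = c' ∧ ∑ t ∈ Finset.range n, r t = q := by
  induction h with
  | nil => exact ⟨0, fun _ => c₀, fun _ => 0, ⟨h₀, by simp⟩, rfl, by simp⟩
  | @snoc d' d'' q r' hrun hstep ih =>
    obtain ⟨n, c, r, htr, hn, hq⟩ := ih
    refine ⟨n + 1, fun t => if t ≤ n then c t else d'', fun t => if t < n then r t else r',
      ⟨by simpa using htr.init, fun t ht => ?_⟩, by simp, ?_⟩
    · rcases Nat.lt_succ_iff_lt_or_eq.mp ht with h | rfl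
      · simpa [h, h.le, Nat.succ_le_of_lt h] using htr.step t h
      · simpa [hn] using hstep
    · rw [Finset.sum_range_succ, ← hq]
      simp only [lt_irrefl, if_false, add_left_inj]
      exact Finset.sum_congr rfl fun t ht => by simp [Finset.mem_range.mp ht]

theorem Step.cost_le_one {c c' : Config V} {r : ℕ} (h : Step E S c c' r) : r ≤ 1 := by
  cases h <;> simp

theorem Step.encard_red_le {c c' : Config V} {r : ℕ} (h : Step E S c c' r)
    (hc : c.red.encard ≤ S) : c'.red.encard ≤ S := by
  cases h with
  | load v hv hS => exact hS
  | store v hv => exact hc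
  | compute v hv hp hS => exact hS
  | deleteRed v => exact (Set.encard_le_encard Set.sdiff_subset).trans hc
  | deleteBlue v => exact hc

/-- Inputs cannot be computed, so each input that enters the fast memory costs a transfer. -/
theorem Step.encard_new_red_le {c c' : Config V} {r : ℕ} (h : Step E S c c' r) :
    (inputs E ∩ (c'.red \ c.red)).encard ≤ r := by
  cases h with
  | load v hv hS =>
    refine (Set.encard_le_encard (t := {v}) ?_).trans (by simp)
    rintro w ⟨-, h, h'⟩
    exact h.resolve_right h'
  | store v hv => simp
  | compute v hv hp hS =>
    rw [Set.encard_eq_zero.mpr]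
    · simp
    · ext w
      simp only [Set.mem_inter_iff, Set.mem_sdiff, Set.mem_insert_iff, Set.mem_empty_iff_false,
        iff_false]
      rintro ⟨hw, rfl | h, h'⟩
      exacts [hv hw, h' h]
  | deleteRed v =>
    rw [Set.encard_eq_zero.mpr]
    · simp
    · ext w; simp +contextual
  | deleteBlue v => simp

theorem Step.encard_new_blue_le {c c' : Config V} {r : ℕ} (h : Step E S c c' r) :
    (c'.blue \ c.blue).encard ≤ r := by
  cases h with
  | store v hv =>
    refine (Set.encard_le_encard (t := {v}) ?_).trans (by simp)
    rintro w ⟨h, h'⟩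
    exact h.resolve_right h'
  | load v hv hS => simp
  | compute v hv hp hS => simp
  | deleteRed v => simp
  | deleteBlue v =>
    rw [Set.encard_eq_zero.mpr]
    · simp
    · ext w; simp +contextual

/-- If nothing in `A` is pebbled before a move and something is afterwards, and every node of `A`
except `a` has a predecessor in `A`, then the move computes `a`. -/
theorem Step.pred_red_of_first {c c' : Config V} {r : ℕ} (h : Step E S c c' r) {A : Set V} {a : V}
    (hA : ∀ v ∈ A, v ≠ a → ∃ u ∈ A, E u v) (hc : ∀ v ∈ A, v ∉ c.red ∧ v ∉ c.blue)
    (hc' : ∃ v ∈ A, v ∈ c'.red ∨ v ∈ c'.blue) : ∀ u, E u a → u ∈ c.red := by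
  obtain ⟨w, hw, hw'⟩ := hc'
  have h₁ := hc w hw
  cases h with
  | load v hv hS =>
    rcases hw' with (rfl | h) | h
    exacts [(h₁.2 hv).elim, (h₁.1 h).elim, (h₁.2 h).elim]
  | store v hv =>
    rcases hw' with h | rfl | h
    exacts [(h₁.1 h).elim, (h₁.1 hv).elim, (h₁.2 h).elim]
  | compute v hv hp hS =>
    rcases hw' with (rfl | h) | h
    · by_cases hwa : w = a
      · exact hwa ▸ hp
      · obtain ⟨u, hu, huw⟩ := hA w hw hwa
        exact ((hc u hu).1 (hp u huw)).elim
    exacts [(h₁.1 h).elim, (h₁.2 h).elim]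
  | deleteRed v =>
    rcases hw' with h | h
    exacts [(h₁.1 h.1).elim, (h₁.2 h).elim]
  | deleteBlue v =>
    rcases hw' with h | h
    exacts [(h₁.1 h).elim, (h₁.2 h.1).elim]

theorem exists_last_not {p : ℕ → Prop} (h₀ : ¬ p 0) {n : ℕ} (hn : p n) :
    ∃ t < n, ¬ p t ∧ ∀ t', t < t' → t' ≤ n → p t' := by
  induction n with
  | zero => exact (h₀ hn).elim
  | succ n ih =>
    by_cases h : p n
    · obtain ⟨t, ht, ht', h'⟩ := ih h
      refine ⟨t, by omega, ht', fun t' h₁ h₂ => ?_⟩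
      rcases h₂.lt_or_eq with h₂ | rfl
      exacts [h' t' h₁ (by omega), hn]
    · exact ⟨n, by omega, h, fun t' h₁ h₂ => by obtain rfl : t' = n + 1 := by omega
                                                exact hn⟩

theorem exists_enter {c : ℕ → Set V} {v : V} {s t : ℕ} (hst : s ≤ t) (hs : v ∉ c s) (ht : v ∈ c t) :
    ∃ t' ∈ Finset.Ico s t, v ∈ c (t' + 1) \ c t' := by
  obtain ⟨d, rfl⟩ := Nat.exists_eq_add_of_le hst
  obtain ⟨u, hu, hu', h⟩ := exists_last_not (p := fun i => v ∈ c (s + i)) hs ht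
  exact ⟨s + u, by simp [hu], h (u + 1) (by omega) (by omega), hu'⟩

theorem encard_biUnion_le_sum {ι α : Type*} (s : Finset ι) (f : ι → Set α) (r : ι → ℕ)
    (h : ∀ i ∈ s, (f i).encard ≤ r i) :
    (⋃ i ∈ s, f i).encard ≤ (∑ i ∈ s, r i : ℕ) := by
  classical
  induction s using Finset.induction_on with
  | empty => simp
  | insert a s ha ih =>
    rw [Finset.set_biUnion_insert, Finset.sum_insert ha]
    push_cast
    refine (Set.encard_union_le _ _).trans (add_le_add (h a (by simp)) ?_)
    exact_mod_cast ih fun i hi => h i (by simp [hi])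

namespace IsTrace

variable {n : ℕ} {c : ℕ → Config V} {r : ℕ → ℕ}

theorem encard_red_le (h : IsTrace E S n c r) {t : ℕ} (ht : t ≤ n) : (c t).red.encard ≤ S := by
  induction t with
  | zero => simp [h.init]
  | succ t ih => exact (h.step t ht).encard_red_le (ih (by omega))

/-- Between the times `s` and `e`, the inputs in the fast memory are those that were there at time
`s` and those that have been loaded. -/
theorem exists_inputs (h : IsTrace E S n c r) {s e ρ : ℕ} (he : e ≤ n)
    (hρ : (c s).red.encard ≤ ρ) :
    ∃ X : Set V, X.encard ≤ (ρ + ∑ t ∈ Finset.Ico s e, r t : ℕ) ∧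
      ∀ t, s ≤ t → t < e → ∀ v ∈ inputs E, v ∈ (c t).red → v ∈ X := by
  refine ⟨(c s).red ∪ ⋃ t ∈ Finset.Ico s e, inputs E ∩ ((c (t + 1)).red \ (c t).red), ?_, ?_⟩
  · rw [Nat.cast_add]
    refine (Set.encard_union_le _ _).trans (add_le_add hρ (encard_biUnion_le_sum _ _ _ ?_))
    intro t ht
    exact (h.step t ((Finset.mem_Ico.mp ht).2.trans_le he)).encard_new_red_le
  · intro t hst hte v hv hvt
    by_cases hvs : v ∈ (c s).red
    · exact Or.inl hvs
    · obtain ⟨t', ht', hv'⟩ := exists_enter (c := fun t => (c t).red) hst hvs hvt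
      refine Or.inr (Set.mem_biUnion (x := t') ?_ ⟨hv, hv'⟩)
      simp only [Finset.coe_Ico, Finset.mem_Ico, Set.mem_Ico] at ht' ⊢
      omega

theorem exists_stored (h : IsTrace E S n c r) {s e : ℕ} (he : e ≤ n) :
    ∃ X : Set V, X.encard ≤ (∑ t ∈ Finset.Ico s e, r t : ℕ) ∧
      ∀ t, s ≤ t → t ≤ e → ∀ v ∉ (c t).blue, v ∈ (c e).blue → v ∈ X := by
  refine ⟨⋃ t ∈ Finset.Ico s e, (c (t + 1)).blue \ (c t).blue, encard_biUnion_le_sum _ _ _ ?_, ?_⟩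
  · intro t ht
    exact (h.step t ((Finset.mem_Ico.mp ht).2.trans_le he)).encard_new_blue_le
  · intro t hst hte v hv hve
    obtain ⟨t', ht', hv'⟩ := exists_enter (c := fun t => (c t).blue) hte hv hve
    refine Set.mem_biUnion (x := t') ?_ hv'
    simp only [Finset.coe_Ico, Finset.mem_Ico, Set.mem_Ico] at ht' ⊢
    omega

/-- The last time at which neither the non-input `a` nor any node that depends on it is pebbled:
the next move computes `a`, and its result is not wasted. Recomputations of `a` that do not
contribute to the output `z` in the end are thus disregarded. -/
theorem exists_useful_compute (h : IsTrace E S n c r) {a z : V} (ha : a ∉ inputs E)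
    (haz : Relation.ReflTransGen E a z) (hz : z ∈ (c n).blue) :
    ∃ t < n, (∀ u, E u a → u ∈ (c t).red) ∧
      (∀ v, Relation.ReflTransGen E a v → v ∉ (c t).blue) ∧
      ∀ t', t < t' → t' ≤ n →
        ∃ v, Relation.ReflTransGen E a v ∧ (v ∈ (c t').red ∨ v ∈ (c t').blue) := by
  have hpred : ∀ v, Relation.ReflTransGen E a v → v ≠ a →
      ∃ u, Relation.ReflTransGen E a u ∧ E u v := fun v hv hva =>
    (Relation.ReflTransGen.cases_tail hv).resolve_left hva
  have h₀ : ¬ ∃ v, Relation.ReflTransGen E a v ∧ (v ∈ (c 0).red ∨ v ∈ (c 0).blue) := by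
    rintro ⟨v, hv, hv'⟩
    simp only [h.init, Set.mem_empty_iff_false, false_or] at hv'
    by_cases hva : v = a
    · exact ha (hva ▸ hv')
    · obtain ⟨u, -, hu⟩ := hpred v hv hva
      exact hv' u hu
  obtain ⟨t, htn, ht, hlater⟩ := exists_last_not
    (p := fun t => ∃ v, Relation.ReflTransGen E a v ∧ (v ∈ (c t).red ∨ v ∈ (c t).blue))
    h₀ (n := n) ⟨z, haz, Or.inr hz⟩
  push Not at ht
  exact ⟨t, htn, (h.step t htn).pred_red_of_first (A := {v | Relation.ReflTransGen E a v})
    hpred ht (hlater (t + 1) (by omega) (by omega)), fun v hv => (ht v hv).2, hlater⟩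

end IsTrace

end RedBlue

/-! ### A discrete Loomis–Whitney inequality -/

/-- If a pair of elements with the same key is determined by the `f`-value of the first and the
`g`-value of the second, then `|M| ^ 2 ≤ |keys of M| * |f(M)| * |g(M)|`. -/
theorem Finset.card_sq_le_of_pairs_injective {μ κ α β : Type*} [DecidableEq κ]
    (M : Finset μ) (key : μ → κ) (f : μ → α) (g : μ → β)
    (K : Finset κ) (X : Finset α) (Y : Finset β)
    (hK : ∀ m ∈ M, key m ∈ K) (hX : ∀ m ∈ M, f m ∈ X) (hY : ∀ m ∈ M, g m ∈ Y)
    (hinj : ∀ m m' n n', key m = key m' → key n = key n' → f m = f n → g m' = g n' →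
      m = n ∧ m' = n') :
    M.card ^ 2 ≤ K.card * (X.card * Y.card) := by
  have h₁ : M.card = ∑ k ∈ K, (M.filter fun m => key m = k).card :=
    Finset.card_eq_sum_card_fiberwise hK
  have h₂ : ∑ k ∈ K, (M.filter fun m => key m = k).card ^ 2 =
      ((M ×ˢ M).filter fun p => key p.1 = key p.2).card := by
    rw [Finset.card_eq_sum_card_fiberwise (f := fun p : μ × μ => key p.1) (t := K)]
    · refine Finset.sum_congr rfl fun k _ => ?_
      rw [sq, ← Finset.card_product]
      congr 1
      ext ⟨a, b⟩
      simp only [Finset.mem_product, Finset.mem_filter]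
      constructor
      · rintro ⟨⟨h, rfl⟩, h', h''⟩
        exact ⟨⟨⟨h, h'⟩, h''.symm⟩, rfl⟩
      · rintro ⟨⟨⟨h, h'⟩, h''⟩, rfl⟩
        exact ⟨⟨h, rfl⟩, h', h''.symm⟩
    · intro p hp
      simp only [Finset.coe_filter, Finset.mem_product, Set.mem_ofPred_eq] at hp
      exact hK _ hp.1.1
  calc M.card ^ 2 = (∑ k ∈ K, (M.filter fun m => key m = k).card) ^ 2 := by rw [← h₁]
    _ ≤ K.card * ∑ k ∈ K, (M.filter fun m => key m = k).card ^ 2 := sq_sum_le_card_mul_sum_sq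
    _ = K.card * ((M ×ˢ M).filter fun p => key p.1 = key p.2).card := by rw [h₂]
    _ ≤ K.card * (X.card * Y.card) := by
      rw [← Finset.card_product X Y]
      refine Nat.mul_le_mul_left _ (Finset.card_le_card_of_injOn
        (fun p : μ × μ => (f p.1, g p.2)) ?_ ?_)
      · intro p hp
        simp only [Finset.coe_filter, Finset.mem_product, Set.mem_ofPred_eq] at hp
        simpa using ⟨hX _ hp.1.1, hY _ hp.1.2⟩
      · rintro ⟨a, b⟩ hp ⟨a', b'⟩ hp' h
        simp only [Finset.coe_filter, Finset.mem_product, Set.mem_ofPred_eq] at hp hp'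
        simp only [Prod.mk.injEq] at h
        obtain ⟨rfl, rfl⟩ := hinj a b a' b' hp.2 hp'.2 h.1 h.2
        rfl

namespace ConvLayer

variable (L : ConvLayer)

/-- The input entry that enters the multiplication `m`. -/
def inputNode (m : L.Out × L.Ker) : L.Node :=
  .input m.1.1
    ⟨L.D * m.1.2.1 + m.2.1, by
      have h := Nat.mul_le_mul_left L.D (Nat.le_sub_one_of_lt m.1.2.1.2)
      have := m.2.1.2
      unfold WI; omega⟩
    ⟨L.D * m.1.2.2.1 + m.2.2.1, by
      have h := Nat.mul_le_mul_left L.D (Nat.le_sub_one_of_lt m.1.2.2.1.2)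
      have := m.2.2.1.2
      unfold HI; omega⟩
    m.2.2.2

/-- The weight that enters the multiplication `m`. -/
def weightNode (m : L.Out × L.Ker) : L.Node := .weight m.1.2.2.2 m.2

/-- The number of `D × D` blocks of kernel positions that are needed to cover the kernel. -/
def blocks : ℕ := ((L.WK - 1) / L.D + 1) * ((L.HK - 1) / L.D + 1)

theorem blocks_le (hW : L.D ≤ L.WK) (hH : L.D ≤ L.HK) : (L.blocks : ℝ) ≤ 4 * L.reuse := by
  have key : ∀ w : ℕ, L.D ≤ w → (((w - 1) / L.D + 1 : ℕ) : ℝ) ≤ 2 * (w / L.D) := by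
    intro w hw
    have hD : (0 : ℝ) < L.D := by exact_mod_cast L.D_pos
    have h₁ : (((w - 1) / L.D : ℕ) : ℝ) ≤ w / L.D :=
      (by exact_mod_cast Nat.div_le_div_right (Nat.sub_le w 1) : _ ≤ ((w / L.D : ℕ) : ℝ)).trans
        Nat.cast_div_le
    have h₂ : (1 : ℝ) ≤ w / L.D := (one_le_div hD).mpr (by exact_mod_cast hw)
    push_cast at h₁ ⊢
    linarith
  calc (L.blocks : ℝ) ≤ (2 * (L.WK / L.D)) * (2 * (L.HK / L.D)) := by
        rw [blocks, Nat.cast_mul]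
        exact mul_le_mul (key _ hW) (key _ hH) (by positivity) (by positivity)
    _ = 4 * L.reuse := by rw [reuse]; ring

/-- The number of multiplications that can be performed with the input entries `X`, the weights `Y`
and the outputs `Z`. Within one `D × D` block of kernel positions the input entry determines the
kernel position and the output position, as in a matrix multiplication. -/
theorem card_mul_sq_le (M : Finset (L.Out × L.Ker)) (X Y : Finset L.Node) (Z : Finset L.Out)
    (hX : ∀ m ∈ M, L.inputNode m ∈ X) (hY : ∀ m ∈ M, L.weightNode m ∈ Y)
    (hZ : ∀ m ∈ M, m.1 ∈ Z) :
    M.card ^ 2 ≤ L.blocks * (Z.card * (X.card * Y.card)) := by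
  have h := Finset.card_sq_le_of_pairs_injective M
    (fun m => (m.1, (m.2.1 : ℕ) / L.D, (m.2.2.1 : ℕ) / L.D)) L.inputNode L.weightNode
    (Z ×ˢ (Finset.range ((L.WK - 1) / L.D + 1) ×ˢ Finset.range ((L.HK - 1) / L.D + 1))) X Y
    ?_ hX hY ?_
  · rw [Finset.card_product, Finset.card_product, Finset.card_range, Finset.card_range,
      ← blocks] at h
    linarith
  · intro m hm
    simp only [Finset.mem_product, Finset.mem_range, Nat.lt_succ_iff]
    exact ⟨hZ m hm, Nat.div_le_div_right (Nat.le_sub_one_of_lt m.2.1.2),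
      Nat.div_le_div_right (Nat.le_sub_one_of_lt m.2.2.1.2)⟩
  · rintro ⟨⟨b, x, y, c⟩, i, j, d⟩ ⟨⟨b', x', y', c'⟩, i', j', d'⟩
      ⟨⟨b₁, x₁, y₁, c₁⟩, i₁, j₁, d₁⟩ ⟨⟨b₁', x₁', y₁', c₁'⟩, i₁', j₁', d₁'⟩ h₁ h₂ h₃ h₄
    simp only [inputNode, weightNode, Prod.mk.injEq, Node.input.injEq, Node.weight.injEq,
      Fin.mk.injEq] at h₁ h₂ h₃ h₄
    obtain ⟨⟨rfl, rfl, rfl, rfl⟩, hi, hj⟩ := h₁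
    obtain ⟨⟨rfl, rfl, rfl, rfl⟩, hi₁, hj₁⟩ := h₂
    obtain ⟨rfl, hx, hy, rfl⟩ := h₃
    obtain ⟨rfl, rfl, rfl, rfl⟩ := h₄
    -- The remainder modulo `D` comes from the input entry, the quotient from the block.
    have key : ∀ x x₁ i i₁ : ℕ, i / L.D = i₁ / L.D → L.D * x + i = L.D * x₁ + i₁ →
        i = i₁ ∧ x = x₁ := by
      intro x x₁ i i₁ h h'
      have hmod : i % L.D = i₁ % L.D := by
        have := congrArg (· % L.D) h'
        simpa using this
      have hi : i = i₁ := by rw [← Nat.div_add_mod i L.D, h, hmod, Nat.div_add_mod]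
      subst hi
      exact ⟨rfl, Nat.eq_of_mul_eq_mul_left L.D_pos (Nat.add_right_cancel h')⟩
    obtain ⟨hi', hx'⟩ := key _ _ _ _ (hi.trans hi₁.symm) hx
    obtain ⟨hj', hy'⟩ := key _ _ _ _ (hj.trans hj₁.symm) hy
    obtain rfl := Fin.ext hi'
    obtain rfl := Fin.ext hj'
    obtain rfl := Fin.ext hx'
    obtain rfl := Fin.ext hy'
    exact ⟨rfl, rfl⟩

/-! ### The convolution graph -/

variable {L} {T : L.Out → AddTree L.Ker}

theorem inputNode_mem_inputs (m : L.Out × L.Ker) : L.inputNode m ∈ RedBlue.inputs (L.Edge T) :=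
  fun _ h => nomatch h

theorem weightNode_mem_inputs (m : L.Out × L.Ker) : L.weightNode m ∈ RedBlue.inputs (L.Edge T) :=
  fun _ h => nomatch h

theorem edge_inputNode (m : L.Out × L.Ker) : L.Edge T (L.inputNode m) (.mul m.1 m.2) :=
  .input_mul _ _ _ _ _ _ _ _ _ rfl rfl

theorem edge_weightNode (m : L.Out × L.Ker) : L.Edge T (L.weightNode m) (.mul m.1 m.2) :=
  .weight_mul _ _ _ _ _

/-- The output to which a multiplication or addition contributes. -/
def Node.owner : L.Node → Option L.Out
  | .input .. => none
  | .weight .. => none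
  | .mul o _ => some o
  | .add o _ => some o

theorem owner_of_reflTransGen {o : L.Out} {k : L.Ker} {v : L.Node}
    (h : Relation.ReflTransGen (L.Edge T) (.mul o k) v) : v.owner = some o := by
  induction h with
  | refl => rfl
  | tail _ he ih => cases he <;> simp_all [Node.owner]

theorem exists_output_of_add (o : L.Out) (n : Fin (Fintype.card L.Ker)) :
    ∃ z ∈ RedBlue.outputs (L.Edge T), Relation.ReflTransGen (L.Edge T) (.add o n) z := by
  induction hd : Fintype.card L.Ker - (n : ℕ) using Nat.strong_induction_on generalizing n with
  | _ d ih =>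
    cases hn : (T o).addParent n with
    | none =>
      refine ⟨_, fun w hw => ?_, .refl⟩
      cases hw with
      | add_add _ _ m h => simp [hn] at h
    | some m =>
      have hlt := (T o).lt_of_addParent n m hn
      obtain ⟨z, hz, h⟩ := ih (Fintype.card L.Ker - (m : ℕ)) (by have := m.2; omega) m rfl
      exact ⟨z, hz, .head (.add_add o n m hn) h⟩

theorem exists_output_of_mul (o : L.Out) (k : L.Ker) :
    ∃ z ∈ RedBlue.outputs (L.Edge T), Relation.ReflTransGen (L.Edge T) (.mul o k) z := by
  obtain ⟨z, hz, h⟩ := exists_output_of_add (T := T) o ((T o).termParent k)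
  exact ⟨z, hz, .head (.mul_add o k) h⟩

end ConvLayer

/-! ### The communication volume -/

theorem Finset.card_le_of_encard_le {α : Type*} {X : Set α} {Y : Finset α} {k : ℕ}
    (hX : X.encard ≤ k) (h : ↑Y ⊆ X) : Y.card ≤ k := by
  have := (Set.encard_le_encard h).trans hX
  rw [Set.encard_coe_eq_coe_finsetCard] at this
  exact_mod_cast this

namespace ConvLayer

open RedBlue

variable {L : ConvLayer} {T : L.Out → AddTree L.Ker}

/-- Let `τ m` be a time at which the multiplication `m` is computed usefully: later on some node
that depends on it always carries a pebble. Between the times `s` and `e` only few multiplications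
can be computed usefully: their operands were in the fast memory at time `s` or have been loaded,
and their outputs have a pebbled node at time `e` that is in the set `P` (say, of red nodes) or has
been stored. -/
theorem card_interval_sq_le {S n : ℕ} {c : ℕ → Config L.Node} {r : ℕ → ℕ}
    (htr : IsTrace (L.Edge T) S n c r) {τ : L.Out × L.Ker → ℕ}
    (hpred : ∀ m u, L.Edge T u (.mul m.1 m.2) → u ∈ (c (τ m)).red)
    (hblue : ∀ m v, Relation.ReflTransGen (L.Edge T) (.mul m.1 m.2) v → v ∉ (c (τ m)).blue)
    {s e ρ : ℕ} (he : e ≤ n) {P : Set L.Node} (hρ : (c s).red.encard ≤ ρ) (hP : P.encard ≤ ρ)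
    (hlater : ∀ m, τ m < e → ∃ v, Relation.ReflTransGen (L.Edge T) (.mul m.1 m.2) v ∧
      (v ∈ P ∨ v ∈ (c e).blue)) :
    (Finset.univ.filter fun m => s ≤ τ m ∧ τ m < e).card ^ 2 ≤
      L.blocks * (ρ + ∑ t ∈ Finset.Ico s e, r t) ^ 3 := by
  classical
  set M := Finset.univ.filter fun m => s ≤ τ m ∧ τ m < e with hM
  have hmem : ∀ m ∈ M, s ≤ τ m ∧ τ m < e := fun m hm => (Finset.mem_filter.mp hm).2
  obtain ⟨X, hXcard, hX⟩ := htr.exists_inputs (s := s) he hρ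
  obtain ⟨Y, hYcard, hY⟩ := htr.exists_stored (s := s) he
  have h₁ : (M.image L.inputNode).card ≤ ρ + ∑ t ∈ Finset.Ico s e, r t := by
    refine Finset.card_le_of_encard_le hXcard fun v hv => ?_
    obtain ⟨m, hm, rfl⟩ := Finset.mem_image.mp hv
    exact hX (τ m) (hmem m hm).1 (hmem m hm).2 _ (inputNode_mem_inputs m)
      (hpred m _ (edge_inputNode m))
  have h₂ : (M.image L.weightNode).card ≤ ρ + ∑ t ∈ Finset.Ico s e, r t := by
    refine Finset.card_le_of_encard_le hXcard fun v hv => ?_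
    obtain ⟨m, hm, rfl⟩ := Finset.mem_image.mp hv
    exact hX (τ m) (hmem m hm).1 (hmem m hm).2 _ (weightNode_mem_inputs m)
      (hpred m _ (edge_weightNode m))
  have h₃ : (M.image Prod.fst).card ≤ ρ + ∑ t ∈ Finset.Ico s e, r t := by
    rw [← Finset.card_image_of_injective _ (Option.some_injective _)]
    refine Finset.card_le_of_encard_le (X := Node.owner '' (P ∪ Y)) ?_ fun v hv => ?_
    · rw [Nat.cast_add]
      exact (Set.encard_image_le _ _).trans
        ((Set.encard_union_le _ _).trans (add_le_add hP hYcard))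
    · simp only [Finset.coe_image, Set.mem_image, Finset.mem_coe] at hv
      obtain ⟨_, ⟨m, hm, rfl⟩, rfl⟩ := hv
      obtain ⟨hs, hτe⟩ := hmem m hm
      obtain ⟨v, hv, hvP | hve⟩ := hlater m hτe
      · exact ⟨v, Or.inl hvP, owner_of_reflTransGen hv⟩
      · exact ⟨v, Or.inr (hY (τ m) hs hτe.le v (hblue m v hv) hve), owner_of_reflTransGen hv⟩
  calc M.card ^ 2 ≤ L.blocks * ((M.image Prod.fst).card *
        ((M.image L.inputNode).card * (M.image L.weightNode).card)) :=
        L.card_mul_sq_le M _ _ _ (fun m => Finset.mem_image_of_mem _)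
          (fun m => Finset.mem_image_of_mem _) (fun m => Finset.mem_image_of_mem _)
    _ ≤ L.blocks * ((ρ + ∑ t ∈ Finset.Ico s e, r t) * ((ρ + ∑ t ∈ Finset.Ico s e, r t) *
        (ρ + ∑ t ∈ Finset.Ico s e, r t))) := by gcongr
    _ = _ := by ring

/-- A computation with at most `S` transfers is a single interval. A longer one is cut into
intervals of at most `S` transfers each; `b` bounds the number of multiplications in such an
interval. -/
theorem card_mul_bounds {S q : ℕ} (hS : 0 < S) (h : Computes (L.Edge T) S q) :
    Fintype.card (L.Out × L.Ker) ^ 2 ≤ L.blocks * q ^ 3 ∧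
      ∃ b : ℕ, b ^ 2 ≤ L.blocks * (S + S) ^ 3 ∧
        Fintype.card (L.Out × L.Ker) ≤ (q / S + 1) * b := by
  classical
  obtain ⟨cf, hrun, hout⟩ := h
  obtain ⟨n, c, r, htr, hn, hq⟩ := hrun.exists_isTrace rfl
  have hτ : ∀ m : L.Out × L.Ker, ∃ t < n, (∀ u, L.Edge T u (.mul m.1 m.2) → u ∈ (c t).red) ∧
      (∀ v, Relation.ReflTransGen (L.Edge T) (.mul m.1 m.2) v → v ∉ (c t).blue) ∧
      ∀ t', t < t' → t' ≤ n → ∃ v, Relation.ReflTransGen (L.Edge T) (.mul m.1 m.2) v ∧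
        (v ∈ (c t').red ∨ v ∈ (c t').blue) := by
    intro m
    obtain ⟨z, hz, hmz⟩ := exists_output_of_mul (T := T) m.1 m.2
    exact htr.exists_useful_compute (fun h => h _ (edge_inputNode m)) hmz (hn ▸ hout hz)
  choose τ hτn hpred hblue hlater using hτ
  refine ⟨?_, ?_⟩
  · have := card_interval_sq_le htr hpred hblue (s := 0) (ρ := 0) le_rfl (P := ∅)
      (by simp [htr.init]) (by simp) fun m _ => by
        obtain ⟨z, hz, hmz⟩ := exists_output_of_mul (T := T) m.1 m.2
        exact ⟨z, hmz, Or.inr (hn ▸ hout hz)⟩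
    simpa [hτn, hq] using this
  · -- `E j` is the last time before which fewer than `j * S` entries are transferred; it is `0`
    -- for `j = 0`, where there is no such time.
    let E : ℕ → ℕ := fun j => Nat.findGreatest (fun t => ∑ i ∈ Finset.range t, r i < j * S) n
    have hEn : ∀ j, E j ≤ n := fun j => Nat.findGreatest_le n
    have hE0 : E 0 = 0 := by simp [E, Nat.findGreatest_eq_zero_iff]
    have hE : ∀ j, ∑ i ∈ Finset.range (E (j + 1)), r i < (j + 1) * S := fun j =>
      Nat.findGreatest_spec (P := fun t => ∑ i ∈ Finset.range t, r i < (j + 1) * S)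
        (Nat.zero_le n) (by simpa using hS)
    have hE' : ∀ j, E j < n → j * S ≤ ∑ i ∈ Finset.range (E j), r i + 1 := fun j hj => by
      have h₁ := Nat.findGreatest_is_greatest (Nat.lt_succ_self (E j)) hj
      have h₂ := (htr.step (E j) hj).cost_le_one
      rw [Finset.sum_range_succ] at h₁
      omega
    have hmono : ∀ j, E j ≤ E (j + 1) := fun j =>
      Nat.findGreatest_mono_left (fun t ht => ht.trans_le (Nat.mul_le_mul_right S (Nat.le_succ j))) n
    have hsum : ∀ j, ∑ t ∈ Finset.Ico (E j) (E (j + 1)), r t ≤ S := fun j => by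
      rcases (hEn j).lt_or_eq with hj | hj
      · have h₁ := Finset.sum_range_add_sum_Ico r (hmono j)
        have h₂ := hE j
        have h₃ := hE' j hj
        rw [Nat.add_mul] at h₂
        omega
      · have := hEn (j + 1)
        rw [Finset.Ico_eq_empty_of_le (by omega)]
        simp
    have hstep : ∀ j, (Finset.univ.filter fun m => E j ≤ τ m ∧ τ m < E (j + 1)).card ≤
        Nat.sqrt (L.blocks * (S + S) ^ 3) := fun j => by
      rw [Nat.le_sqrt']
      refine (card_interval_sq_le htr hpred hblue (hEn (j + 1)) (htr.encard_red_le (hEn j))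
        (htr.encard_red_le (hEn (j + 1)))
        fun m hm => hlater m _ hm (hEn (j + 1))).trans ?_
      gcongr
      exact hsum j
    have hcount : ∀ j, (Finset.univ.filter fun m => τ m < E j).card ≤
        j * Nat.sqrt (L.blocks * (S + S) ^ 3) := by
      intro j
      induction j with
      | zero => simp [hE0]
      | succ j ih =>
        have hsub : (Finset.univ.filter fun m => τ m < E (j + 1)) ⊆
            (Finset.univ.filter fun m => τ m < E j) ∪
              (Finset.univ.filter fun m => E j ≤ τ m ∧ τ m < E (j + 1)) := by
          intro m hm
          simp only [Finset.mem_union, Finset.mem_filter, Finset.mem_univ, true_and] at hm ⊢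
          omega
        have := (Finset.card_le_card hsub).trans (Finset.card_union_le _ _)
        have := hstep j
        rw [Nat.add_mul]
        omega
    have hlast : E (q / S + 1) = n :=
      (hEn _).antisymm (Nat.le_findGreatest le_rfl (by
        rw [hq, mul_comm]
        exact Nat.lt_mul_div_succ q hS))
    refine ⟨_, Nat.sqrt_le' _, ?_⟩
    simpa [hlast, hτn] using hcount (q / S + 1)

end ConvLayer

theorem theorem2 :
    ∃ c : ℝ, 0 < c ∧
      ∀ (L : ConvLayer) (T : L.Out → AddTree L.Ker) (S : ℕ),
        0 < S → L.D ≤ L.WK → L.D ≤ L.HK →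
          ∀ q : ℕ, RedBlue.Computes (L.Edge T) S q →
            c * (((L.B : ℝ) * L.WO * L.HO * L.CO * L.WK * L.HK * L.CI) / √(L.reuse * S)) ≤ q := by
  refine ⟨1 / 12, by norm_num, fun L T S hS hW hH q h => ?_⟩
  obtain ⟨h₁, b, hb, h₂⟩ := ConvLayer.card_mul_bounds hS h
  have hcard : ((L.B : ℝ) * L.WO * L.HO * L.CO * L.WK * L.HK * L.CI) =
      (Fintype.card (L.Out × L.Ker) : ℕ) := by
    simp only [Fintype.card_prod, Fintype.card_fin]
    push_cast
    ring
  rw [hcard]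
  generalize Fintype.card (L.Out × L.Ker) = N at h₁ h₂
  have hS' : (0 : ℝ) < S := by exact_mod_cast hS
  have hD : (0 : ℝ) < L.D := by exact_mod_cast L.D_pos
  have hWK : (0 : ℝ) < L.WK := by exact_mod_cast L.WK_pos
  have hHK : (0 : ℝ) < L.HK := by exact_mod_cast L.HK_pos
  have hR : 0 < L.reuse := by unfold ConvLayer.reuse; positivity
  have hblocks := L.blocks_le hW hH
  have hpos : 0 < √(L.reuse * S) := Real.sqrt_pos.mpr (by positivity)
  rw [← mul_div_assoc, div_le_iff₀ hpos]
  have hsq : √(L.reuse * S) ^ 2 = L.reuse * S := Real.sq_sqrt (by positivity)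
  set w := √(L.reuse * S)
  rcases le_or_gt q S with hqS | hqS
  · have hqS' : (q : ℝ) ≤ S := by exact_mod_cast hqS
    have h₃ : (N : ℝ) ^ 2 ≤ (2 * (q * w)) ^ 2 := by
      calc (N : ℝ) ^ 2 ≤ L.blocks * q ^ 3 := by exact_mod_cast h₁
        _ ≤ (4 * L.reuse) * (q ^ 2 * S) := by
          rw [pow_succ (q : ℝ) 2]
          gcongr
        _ = (2 * (q * w)) ^ 2 := by rw [mul_pow, mul_pow, hsq]; ring
    have h₄ := (pow_le_pow_iff_left₀ (by positivity) (by positivity) two_ne_zero).mp h₃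
    have : 0 ≤ q * w := by positivity
    linarith
  · have hqS' : (S : ℝ) < q := by exact_mod_cast hqS
    have h₃ : (b : ℝ) ^ 2 ≤ (6 * (S * w)) ^ 2 := by
      calc (b : ℝ) ^ 2 ≤ L.blocks * (S + S) ^ 3 := by exact_mod_cast hb
        _ ≤ (4 * L.reuse) * (S + S) ^ 3 := by gcongr
        _ ≤ 36 * (L.reuse * S) * S ^ 2 := by
          have : 0 ≤ L.reuse * (S : ℝ) ^ 3 := by positivity
          nlinarith
        _ = (6 * (S * w)) ^ 2 := by rw [mul_pow, mul_pow, hsq]; ring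
    have h₄ := (pow_le_pow_iff_left₀ (by positivity) (by positivity) two_ne_zero).mp h₃
    have h₅ : (N : ℝ) ≤ ((q / S : ℕ) + 1) * b := by exact_mod_cast h₂
    have h₆ : ((q / S : ℕ) : ℝ) ≤ q / S := Nat.cast_div_le
    have h₇ : (1 : ℝ) ≤ q / S := (one_le_div hS').mpr hqS'.le
    have h₈ : (N : ℝ) ≤ (2 * (q / S)) * (6 * (S * w)) := by
      refine h₅.trans (mul_le_mul ?_ h₄ (by positivity) (by positivity))
      linarith
    have h₉ : (2 * ((q : ℝ) / S)) * (6 * (S * w)) = 12 * (q * w) := by field_simp; ring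
    linarith
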